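/- Let $(\mathcal C,\mathbb E,\mathfrak s)$ be an extriangulated category in the sense of Nakaoka and Palu, and write an $\mathbb E$-triangle as $A\xrightarrow{x}B\xrightarrow{y}C\overset{\delta}{\dashrightarrow}$, where $\delta\in\mathbb E(C,A)$ is realized by the sequence $A\xrightarrow{x}B\xrightarrow{y}C$. It splits if $\delta=0$. Let $\mathcal X$ be a full subcategory of $\mathcal C$ which is pseudo cluster tilting, that is, for every object $C$ of $\mathcal C$ there are $\mathbb E$-triangles $$C\xrightarrow{a}X_1\to X_2\dashrightarrow\qquad\text{and}\qquad X_3\to X_4\xrightarrow{d}C\dashrightarrow$$ with $X_1,X_2,X_3,X_4\in\mathcal X$ such that, for all $X\in\mathcal X$, the maps $\mathcal C(a,X)\colon\mathcal C(X_1,X)\to\mathcal C(C,X)$ and $\mathcal C(X,d)\colon\mathcal C(X,X_4)\to\mathcal C(X,C)$ are surjective. Let $\mathcal C/\mathcal X$ be the additive quotient category, which has the objects of $\mathcal C$ and the morphism groups $\mathcal C(A,B)/\mathcal X(A,B)$, where $\mathcal X(A,B)$ is the subgroup of morphisms which factor through an object of $\mathcal X$. An $\mathbb E$-triangle $A\to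 B\to C\dashrightarrow$ is called $\mathcal C(\mathcal X,-)$-exact if $\mathcal C(X,A)\to\mathcal C(X,B)\to\mathcal C(X,C)\to0$ is exact for all $X\in\mathcal X$, and $\mathcal C(-,\mathcal X)$-exact if $\mathcal C(C,X)\to\mathcal C(B,X)\to\mathcal C(A,X)\to0$ is exact for all $X\in\mathcal X$. Consider commutative diagrams of $\mathbb E$-triangles $$\begin{array}{ccccc} A&\to&B&\xrightarrow{f'}&D&\overset{\delta_1}{\dashrightarrow}\\ \|&&\downarrow&&\downarrow{\scriptstyle d}&\\ A&\to&G&\to&H&\overset{\delta_2}{\dashrightarrow}\\ &&\downarrow&&\downarrow&\\ &&F&=&F& \end{array}$$ in which the two rows $A\to B\to D\overset{\delta_1}{\dashrightarrow}$ and $A\to G\to H\overset{\delta_2}{\dashrightarrow}$ and the two columns $B\to G\to F\overset{\varepsilon_1}{\dashrightarrow}$ and $D\to H\to F\overset{\varepsilon_2}{\dashrightarrow}$ are $\mathbb E$-triangles, and the rows, respectively the columns, form a morphism of $\mathbb E$-triangles, that is, $\delta_1=d^*\delta_2$ and $f'_*\varepsilon_1=\varepsilon_2$. Let $\mathcal S$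 be the class of the $\mathbb E$-triangles which occur as the left column $B\to G\to F\dashrightarrow$ of such a diagram whose lower row $A\to G\to H\dashrightarrow$ is $\mathcal C(\mathcal X,-)$-exact and whose right column $D\to H\to F\dashrightarrow$ is $\mathcal C(-,\mathcal X)$-exact. Let $\mathcal T$ be the class of the $\mathbb E$-triangles which occur as the lower row $A\to G\to H\dashrightarrow$ of such a diagram whose left column $B\to G\to F\dashrightarrow$ is $\mathcal C(-,\mathcal X)$-exact and whose upper row $A\to B\to D\dashrightarrow$ is $\mathcal C(\mathcal X,-)$-exact. The subcategory $\mathcal X$ is called self-orthogonal with respect to a class $\mathcal Y$ of $\mathbb E$-triangles if every $\mathbb E$-triangle in $\mathcal Y$ whose first and third terms lie in $\mathcal X$ splits. Then the following statements are equivalent: 1. $\mathcal C/\mathcal X$ is an abelian category; 2. $\mathcal X$ is self-orthogonal with respect to $\mathcal S$; 3. $\mathcal X$ is self-orthogonal with respect to $\mathcal T$. -/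

import Mathlib

open CategoryTheory CategoryTheory.Limits Opposite

universe w v u

namespace Extri

section Bifunctor

variable {C : Type u} [Category.{v} C] (E : Cᵒᵖ ⥤ C ⥤ AddCommGrpCat.{w})

/-- The group `E(Z, A)` of `E`-extensions. -/
abbrev Extn (Z A : C) : Type w := ((E.obj (op Z)).obj A : AddCommGrpCat.{w})

/-- The extension `a_* δ = E(Z, a)(δ)`. -/
def push {Z A A' : C} (a : A ⟶ A') (δ : Extn E Z A) : Extn E Z A' :=
  ((E.obj (op Z)).map a).hom δ

/-- The extension `c^* δ = E(c, A)(δ)`. -/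
def pull {Z Z' A : C} (c : Z' ⟶ Z) (δ : Extn E Z A) : Extn E Z' A :=
  ((E.map c.op).app A).hom δ

/-- The extension `δ ⊕ δ'` in `E(Z ⊞ Z', A ⊞ A')`, with components `(δ, 0, 0, δ')`. -/
noncomputable def dsum [Preadditive C] [HasBinaryBiproducts C] {Z A Z' A' : C}
    (δ : Extn E Z A) (δ' : Extn E Z' A') : Extn E (Z ⊞ Z') (A ⊞ A') :=
  pull E biprod.fst (push E biprod.inl δ) + pull E biprod.snd (push E biprod.inr δ')

end Bifunctor

/-- A sequence `A ⟶ B ⟶ Z` with prescribed end terms. -/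
structure Sq {C : Type u} [Category.{v} C] (A Z : C) where
  /-- the middle term -/
  mid : C
  /-- the first morphism -/
  x : A ⟶ mid
  /-- the second morphism -/
  y : mid ⟶ Z

/-- Two sequences with the same end terms are equivalent if there is an isomorphism between the
middle terms which is compatible with the identities of the end terms. -/
def sqSetoid {C : Type u} [Category.{v} C] (A Z : C) : Setoid (Sq A Z) where
  r s t := ∃ e : s.mid ≅ t.mid, s.x ≫ e.hom = t.x ∧ e.hom ≫ t.y = s.y
  iseqv :=
    { refl := fun s => ⟨Iso.refl _, by simp, by simp⟩
      symm := by
        rintro s t ⟨e, h₁, h₂⟩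
        exact ⟨e.symm, by simp [← h₁], by simp [← h₂]⟩
      trans := by
        rintro s t r ⟨e, h₁, h₂⟩ ⟨e', h₃, h₄⟩
        exact ⟨e ≪≫ e', by simp [← h₁, ← h₃], by simp [← h₂, ← h₄]⟩ }

/-- The equivalence class `[A ⟶ B ⟶ Z]`. -/
def sqClass {C : Type u} [Category.{v} C] {A B Z : C} (x : A ⟶ B) (y : B ⟶ Z) :
    _root_.Quotient (sqSetoid A Z) :=
  _root_.Quotient.mk (sqSetoid A Z) ⟨B, x, y⟩

/-- An extriangulated structure `(E, s)` on an additive category, in the sense of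
Nakaoka and Palu. -/
structure ExtriangulatedStructure (C : Type u) [Category.{v} C] [Preadditive C]
    [HasZeroObject C] [HasBinaryBiproducts C] where
  /-- the bifunctor of extensions -/
  E : Cᵒᵖ ⥤ C ⥤ AddCommGrpCat.{w}
  additive_left : E.Additive
  additive_right : ∀ Z : Cᵒᵖ, (E.obj Z).Additive
  /-- the realization -/
  s : ∀ {Z A : C}, Extn E Z A → _root_.Quotient (sqSetoid A Z)
  /-- morphisms of extensions are realized by morphisms of sequences -/
  realization : ∀ {A B Z A' B' Z' : C} {x : A ⟶ B} {y : B ⟶ Z} {x' : A' ⟶ B'} {y' : B' ⟶ Z'}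
    {δ : Extn E Z A} {δ' : Extn E Z' A'},
    s δ = sqClass x y → s δ' = sqClass x' y' →
    ∀ (a : A ⟶ A') (c : Z ⟶ Z'), push E a δ = pull E c δ' →
    ∃ b : B ⟶ B', x ≫ b = a ≫ x' ∧ y ≫ c = b ≫ y'
  /-- the zero extension is realized by the split sequence -/
  s_zero : ∀ A Z : C,
    s (0 : Extn E Z A) = sqClass (biprod.inl : A ⟶ A ⊞ Z) (biprod.snd : A ⊞ Z ⟶ Z)
  /-- the realization is compatible with direct sums -/
  s_dsum : ∀ {A B Z A' B' Z' : C} {x : A ⟶ B} {y : B ⟶ Z} {x' : A' ⟶ B'} {y' : B' ⟶ Z'}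
    {δ : Extn E Z A} {δ' : Extn E Z' A'},
    s δ = sqClass x y → s δ' = sqClass x' y' →
    s (dsum E δ δ') = sqClass (biprod.map x x') (biprod.map y y')
  /-- the axiom (ET3) -/
  et3 : ∀ {A B Z A' B' Z' : C} {x : A ⟶ B} {y : B ⟶ Z} {x' : A' ⟶ B'} {y' : B' ⟶ Z'}
    {δ : Extn E Z A} {δ' : Extn E Z' A'},
    s δ = sqClass x y → s δ' = sqClass x' y' →
    ∀ (a : A ⟶ A') (b : B ⟶ B'), x ≫ b = a ≫ x' →
    ∃ c : Z ⟶ Z', y ≫ c = b ≫ y' ∧ push E a δ = pull E c δ'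
  /-- the axiom (ET3)^op -/
  et3op : ∀ {A B Z A' B' Z' : C} {x : A ⟶ B} {y : B ⟶ Z} {x' : A' ⟶ B'} {y' : B' ⟶ Z'}
    {δ : Extn E Z A} {δ' : Extn E Z' A'},
    s δ = sqClass x y → s δ' = sqClass x' y' →
    ∀ (b : B ⟶ B') (c : Z ⟶ Z'), y ≫ c = b ≫ y' →
    ∃ a : A ⟶ A', x ≫ b = a ≫ x' ∧ push E a δ = pull E c δ'
  /-- the axiom (ET4) -/
  et4 : ∀ {A B D G F : C} {f : A ⟶ B} {f' : B ⟶ D} {g : B ⟶ G} {g' : G ⟶ F}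
    {δ : Extn E D A} {δ' : Extn E F B},
    s δ = sqClass f f' → s δ' = sqClass g g' →
    ∃ (H : C) (d : D ⟶ H) (e : H ⟶ F) (h' : G ⟶ H) (δ'' : Extn E H A),
      s δ'' = sqClass (f ≫ g) h' ∧ g ≫ h' = f' ≫ d ∧ h' ≫ e = g' ∧
      s (push E f' δ') = sqClass d e ∧ pull E d δ'' = δ ∧ push E f δ'' = pull E e δ'
  /-- the axiom (ET4)^op -/
  et4op : ∀ {D A B F G : C} {f' : D ⟶ A} {f : A ⟶ B} {g' : F ⟶ B} {g : B ⟶ G}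
    {δ : Extn E B D} {δ' : Extn E G F},
    s δ = sqClass f' f → s δ' = sqClass g' g →
    ∃ (H : C) (d : D ⟶ H) (e : H ⟶ F) (h' : H ⟶ A) (δ'' : Extn E G H),
      s δ'' = sqClass h' (f ≫ g) ∧ d ≫ h' = f' ∧ e ≫ g' = h' ≫ f ∧
      s (pull E g' δ) = sqClass d e ∧ push E e δ'' = δ' ∧ push E d δ = pull E g δ''

/-- The morphism `f` factors through an object of the full subcategory `X`. -/
def FactorsThrough {C : Type u} [Category.{v} C] (X : ObjectProperty C) {A B : C}
    (f : A ⟶ B) : Prop :=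
  ∃ (M : C) (_ : X M) (i : A ⟶ M) (j : M ⟶ B), f = i ≫ j

theorem factorsThrough_neg {C : Type u} [Category.{v} C] [Preadditive C] {X : ObjectProperty C}
    {A B : C} {f : A ⟶ B} (hf : FactorsThrough X f) : FactorsThrough X (-f) := by
  obtain ⟨M, hM, i, j, rfl⟩ := hf
  exact ⟨M, hM, i, -j, by simp⟩

/-- Two morphisms are identified in `C/X` if their difference factors through an object
of `X`. -/
def quotRel {C : Type u} [Category.{v} C] [Preadditive C] (X : ObjectProperty C) : HomRel C :=
  fun _ _ f g => FactorsThrough X (f - g)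

/-- The quotient category `C/X`. -/
abbrev ModSub {C : Type u} [Category.{v} C] [Preadditive C] (X : ObjectProperty C) : Type u :=
  CategoryTheory.Quotient (quotRel X)

/-- `f` is a left `X`-approximation of `A`. -/
def IsLeftApprox {C : Type u} [Category.{v} C] (X : ObjectProperty C) {A B : C}
    (f : A ⟶ B) : Prop :=
  X B ∧ ∀ M : C, X M → Function.Surjective (fun g : B ⟶ M => f ≫ g)

/-- `f` is a right `X`-approximation of `B`. -/
def IsRightApprox {C : Type u} [Category.{v} C] (X : ObjectProperty C) {A B : C}
    (f : A ⟶ B) : Prop :=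
  X A ∧ ∀ M : C, X M → Function.Surjective (fun g : M ⟶ A => g ≫ f)

namespace ExtriangulatedStructure

variable {C : Type u} [Category.{v} C] [Preadditive C] [HasZeroObject C]
  [HasBinaryBiproducts C] (T : ExtriangulatedStructure.{w} C)

/-- An `E`-triangle `A ⟶ B ⟶ Z ⇢`. -/
structure Triangle where
  /-- first term -/
  A : C
  /-- middle term -/
  B : C
  /-- last term -/
  Z : C
  /-- first morphism -/
  x : A ⟶ B
  /-- second morphism -/
  y : B ⟶ Z
  /-- the extension -/
  δ : Extn T.E Z A
  realizes : T.s δ = sqClass x y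

variable {T}

/-- An `E`-triangle splits if its extension vanishes. -/
def Triangle.Splits (t : T.Triangle) : Prop := t.δ = 0

/-- `C(X, -)`-exactness: `C(M, A) ⟶ C(M, B) ⟶ C(M, Z) ⟶ 0` is exact for all `M` in `X`. -/
def Triangle.CovExact (X : ObjectProperty C) (t : T.Triangle) : Prop :=
  ∀ M : C, X M →
    Function.Exact (fun f : M ⟶ t.A => f ≫ t.x) (fun f : M ⟶ t.B => f ≫ t.y) ∧
    Function.Surjective (fun f : M ⟶ t.B => f ≫ t.y)

/-- `C(-, X)`-exactness: `C(Z, M) ⟶ C(B, M) ⟶ C(A, M) ⟶ 0` is exact for all `M` in `X`. -/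
def Triangle.ContraExact (X : ObjectProperty C) (t : T.Triangle) : Prop :=
  ∀ M : C, X M →
    Function.Exact (fun f : t.Z ⟶ M => t.y ≫ f) (fun f : t.B ⟶ M => t.x ≫ f) ∧
    Function.Surjective (fun f : t.B ⟶ M => t.x ≫ f)

variable (T)

/-- A commutative diagram of `E`-triangles
```
A --f--> B --f'--> D --δ-->
|        |g        |d
A --h--> G --h'--> H --δh-->
         |g'       |e
         F ======= F
         |δg       |δd
```
in which the two rows, and likewise the two columns, form a morphism of `E`-triangles. -/
structure Diagram where
  (A B D G H F : C)
  (f : A ⟶ B) (f' : B ⟶ D)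
  (h : A ⟶ G) (h' : G ⟶ H)
  (g : B ⟶ G) (g' : G ⟶ F)
  (d : D ⟶ H) (e : H ⟶ F)
  (δf : Extn T.E D A) (δh : Extn T.E H A) (δg : Extn T.E F B) (δd : Extn T.E F D)
  real_f : T.s δf = sqClass f f'
  real_h : T.s δh = sqClass h h'
  real_g : T.s δg = sqClass g g'
  real_d : T.s δd = sqClass d e
  comm_left : f ≫ g = h
  comm_sq : f' ≫ d = g ≫ h'
  comm_right : h' ≫ e = g'
  row_ext : δf = pull T.E d δh
  col_ext : push T.E f' δg = δd

variable {T}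

/-- The upper row. -/
def Diagram.row₁ (Δ : T.Diagram) : T.Triangle := ⟨Δ.A, Δ.B, Δ.D, Δ.f, Δ.f', Δ.δf, Δ.real_f⟩
/-- The lower row. -/
def Diagram.row₂ (Δ : T.Diagram) : T.Triangle := ⟨Δ.A, Δ.G, Δ.H, Δ.h, Δ.h', Δ.δh, Δ.real_h⟩
/-- The left column. -/
def Diagram.col₁ (Δ : T.Diagram) : T.Triangle := ⟨Δ.B, Δ.G, Δ.F, Δ.g, Δ.g', Δ.δg, Δ.real_g⟩
/-- The right column. -/
def Diagram.col₂ (Δ : T.Diagram) : T.Triangle := ⟨Δ.D, Δ.H, Δ.F, Δ.d, Δ.e, Δ.δd, Δ.real_d⟩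

variable (T)

/-- The class `S`: left columns of diagrams whose lower row is `C(X, -)`-exact and whose right
column is `C(-, X)`-exact. -/
def classS (X : ObjectProperty C) : Set T.Triangle :=
  {t | ∃ Δ : T.Diagram, Δ.col₁ = t ∧ Δ.row₂.CovExact X ∧ Δ.col₂.ContraExact X}

/-- The class `T`: lower rows of diagrams whose left column is `C(-, X)`-exact and whose upper
row is `C(X, -)`-exact. -/
def classT (X : ObjectProperty C) : Set T.Triangle :=
  {t | ∃ Δ : T.Diagram, Δ.row₂ = t ∧ Δ.col₁.ContraExact X ∧ Δ.row₁.CovExact X}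

/-- `X` is self-orthogonal with respect to the class `Y` of `E`-triangles. -/
def SelfOrthogonal (X : ObjectProperty C) (Y : Set T.Triangle) : Prop :=
  ∀ t ∈ Y, X t.A → X t.Z → t.Splits

/-- `X` is a pseudo cluster tilting subcategory: every object `A` admits `E`-triangles
`A ⟶ M ⟶ N ⇢` and `N' ⟶ M' ⟶ A ⇢` with the other terms in `X`, in which the morphism out of
(into) `A` is a left (right) `X`-approximation. -/
structure IsPseudoClusterTilting (X : ObjectProperty C) : Prop where
  left : ∀ A : C, ∃ (M N : C) (a : A ⟶ M) (b : M ⟶ N) (δ : Extn T.E N A),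
    T.s δ = sqClass a b ∧ X M ∧ X N ∧ IsLeftApprox X a
  right : ∀ A : C, ∃ (N M : C) (c : N ⟶ M) (d : M ⟶ A) (δ : Extn T.E A N),
    T.s δ = sqClass c d ∧ X N ∧ X M ∧ IsRightApprox X d

variable {T} {X : ObjectProperty C}

namespace IsPseudoClusterTilting

theorem factorsThrough_add (hX : T.IsPseudoClusterTilting X) {A B : C} {f g : A ⟶ B}
    (hf : FactorsThrough X f) (hg : FactorsThrough X g) : FactorsThrough X (f + g) := by
  obtain ⟨M, hM, i, j, rfl⟩ := hf
  obtain ⟨M', hM', i', j', rfl⟩ := hg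
  obtain ⟨L, -, a, -, -, -, hL, -, -, ha⟩ := hX.left A
  obtain ⟨k, hk⟩ := ha M hM i
  obtain ⟨k', hk'⟩ := ha M' hM' i'
  refine ⟨L, hL, a, k ≫ j + k' ≫ j', ?_⟩
  dsimp only at hk hk'
  rw [Preadditive.comp_add, ← Category.assoc, ← Category.assoc, hk, hk']

theorem factorsThrough_zero (hX : T.IsPseudoClusterTilting X) (A B : C) :
    FactorsThrough X (0 : A ⟶ B) := by
  obtain ⟨L, -, a, -, -, -, hL, -⟩ := hX.left A
  exact ⟨L, hL, a, 0, by simp⟩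

/-- The morphisms factoring through `X` form a two-sided ideal, so that the morphisms of `C/X`
from `A` to `B` are exactly the elements of `C(A, B)/X(A, B)`. -/
theorem congruence (hX : T.IsPseudoClusterTilting X) : Congruence (quotRel X) where
  comp_left := by
    rintro A B D f g g' ⟨M, hM, i, j, h⟩
    exact ⟨M, hM, f ≫ i, j, by rw [← Preadditive.comp_sub, h, Category.assoc]⟩
  comp_right := by
    rintro A B D f f' g ⟨M, hM, i, j, h⟩
    exact ⟨M, hM, i, j ≫ g, by rw [← Preadditive.sub_comp, h, Category.assoc]⟩
  equivalence :=
    { refl := fun f => by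
        change FactorsThrough X (f - f)
        rw [sub_self]
        exact hX.factorsThrough_zero _ _
      symm := fun {f g} h => by
        change FactorsThrough X (g - f)
        rw [← neg_sub]
        exact factorsThrough_neg h
      trans := fun {f g k} h h' => by
        change FactorsThrough X (f - k)
        rw [← sub_add_sub_cancel f g k]
        exact hX.factorsThrough_add h h' }

/-- The additive structure of `C/X`, induced from `C`. -/
@[reducible]
def preadditive (hX : T.IsPseudoClusterTilting X) : Preadditive (ModSub X) :=
  letI := hX.congruence
  CategoryTheory.Quotient.preadditive (quotRel X) (by
    intro A B f₁ f₂ g₁ g₂ h h'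
    change FactorsThrough X (f₁ + g₁ - (f₂ + g₂))
    rw [add_sub_add_comm]
    exact hX.factorsThrough_add h h')

/-- The quotient category `C/X`, with its induced additive structure, is abelian. -/
def QuotientIsAbelian (hX : T.IsPseudoClusterTilting X) : Prop :=
  ∃ h : Abelian (ModSub X), h.toPreadditive = hX.preadditive

end IsPseudoClusterTilting

end ExtriangulatedStructure

end Extri

/-! ### Functoriality of extensions. -/

namespace Extri

section Bifunctor

variable {C : Type u} [Category.{v} C] {E : Cᵒᵖ ⥤ C ⥤ AddCommGrpCat.{w}}

/-! Both orthogonality conditions turn out to be equivalent to `C/X` being balanced, and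
balancedness is all that `C/X` can lack of being abelian.

For the latter, adding a left approximation `a : D ⟶ M` to `f : D ⟶ H` changes nothing in `C/X`, but
makes `(a, f)` an inflation along which every map from `D` to an object of `X` extends. Its
deflation gives a cokernel of `f` in `C/X`; kernels are dual. Pulling this triangle back along a
right approximation of its third term shows that `f` is an epimorphism followed by a weak kernel
(`exists_epi_comp_weakKernel`). If `C/X` is balanced and `f` is mono, that epimorphism is
invertible, so `f` is a kernel.

If `C/X` is balanced and a diagram defining `S` has `B` and `F` in `X`, then `d` is mono and epi in
`C/X`, hence invertible there; exactness of the right column corrects its inverse to an honest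
retraction, and exactness of the lower row transports the splitting to the left column.

Conversely, the key lemma `eq_zero_of_monoMod` fits a `C(-, X)`-exact triangle `D ⟶ H ⟶ F`, with `F`
in `X` and first map mono in `C/X`, as the right column of a diagram defining `S` with `B` in `X`,
so self-orthogonality splits it. For `f` mono and epi, the deflation of the triangle of `(a, f)`
factors through some `L` in `X`; the lemma applies to the pullback to `L`, and the splitting yields
an inverse of `f` modulo `X`. The class `T` is treated dually, using `eq_zero_of_epiMod`. -/

theorem push_comp {Z A A' A'' : C} (a : A ⟶ A') (b : A' ⟶ A'') (δ : Extn E Z A) :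
    push E (a ≫ b) δ = push E b (push E a δ) := by
  simp [push]

theorem pull_comp {Z Z' Z'' A : C} (b : Z'' ⟶ Z') (c : Z' ⟶ Z) (δ : Extn E Z A) :
    pull E (b ≫ c) δ = pull E b (pull E c δ) := by
  simp [pull]

theorem push_id {Z A : C} (δ : Extn E Z A) : push E (𝟙 A) δ = δ := by
  simp [push]

theorem pull_id {Z A : C} (δ : Extn E Z A) : pull E (𝟙 Z) δ = δ := by
  simp [pull]

theorem push_zero {Z A A' : C} (a : A ⟶ A') : push E a (0 : Extn E Z A) = 0 :=
  map_zero _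

theorem pull_zero {Z Z' A : C} (c : Z' ⟶ Z) : pull E c (0 : Extn E Z A) = 0 :=
  map_zero _

theorem push_add {Z A A' : C} (a : A ⟶ A') (δ δ' : Extn E Z A) :
    push E a (δ + δ') = push E a δ + push E a δ' :=
  map_add _ _ _

theorem pull_add {Z Z' A : C} (c : Z' ⟶ Z) (δ δ' : Extn E Z A) :
    pull E c (δ + δ') = pull E c δ + pull E c δ' :=
  map_add _ _ _

theorem push_pull {Z Z' A A' : C} (a : A ⟶ A') (c : Z' ⟶ Z) (δ : Extn E Z A) :
    push E a (pull E c δ) = pull E c (push E a δ) := by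
  have h := (E.map c.op).naturality a
  exact congrArg (fun φ => φ.hom δ) h.symm

end Bifunctor

theorem sqClass_eq {C : Type u} [Category.{v} C] {A B B' Z : C} {x : A ⟶ B} {y : B ⟶ Z}
    {x' : A ⟶ B'} {y' : B' ⟶ Z} (e : B ≅ B') (hx : x ≫ e.hom = x') (hy : e.hom ≫ y' = y) :
    sqClass x y = sqClass x' y' :=
  _root_.Quotient.sound ⟨e, hx, hy⟩

theorem exists_iso_of_sqClass_eq {C : Type u} [Category.{v} C] {A B B' Z : C} {x : A ⟶ B}
    {y : B ⟶ Z} {x' : A ⟶ B'} {y' : B' ⟶ Z} (h : sqClass x y = sqClass x' y') :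
    ∃ e : B ≅ B', x ≫ e.hom = x' ∧ e.hom ≫ y' = y :=
  _root_.Quotient.exact h

/-! ### Exact sequences of an `E`-triangle, and enlarging inflations and deflations. -/

namespace ExtriangulatedStructure

variable {C : Type u} [Category.{v} C] [Preadditive C] [HasZeroObject C]
  [HasBinaryBiproducts C] (T : ExtriangulatedStructure.{w} C)

theorem exists_realization {Z A : C} (δ : Extn T.E Z A) :
    ∃ (B : C) (x : A ⟶ B) (y : B ⟶ Z), T.s δ = sqClass x y := by
  obtain ⟨⟨B, x, y⟩, h⟩ := Quot.exists_rep (T.s δ)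
  exact ⟨B, x, y, h.symm⟩

open ZeroObject

/-- Comparing a triangle with this one and its dual `s_zero_id'` turns the axioms on morphisms of
triangles into the exactness statements below. -/
theorem s_zero_id (A : C) : T.s (0 : Extn T.E (0 : C) A) = sqClass (𝟙 A) (0 : A ⟶ 0) := by
  rw [T.s_zero]
  refine sqClass_eq ⟨biprod.fst, biprod.inl, ?_, ?_⟩ (by simp) ((isZero_zero C).eq_of_tgt _ _)
  · ext; simp
  · simp

theorem s_zero_id' (A : C) : T.s (0 : Extn T.E A (0 : C)) = sqClass (0 : 0 ⟶ A) (𝟙 A) := by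
  rw [T.s_zero]
  refine sqClass_eq ⟨biprod.snd, biprod.inr, ?_, ?_⟩ (by simp) (by simp)
  · ext; simp
  · simp

variable {T}

theorem push_neg_hom {Z A A' : C} (a : A ⟶ A') (δ : Extn T.E Z A) :
    push T.E (-a) δ = -push T.E a δ := by
  have := T.additive_right (op Z)
  simp [push, Functor.map_neg]

theorem pull_neg_hom {Z Z' A : C} (c : Z' ⟶ Z) (δ : Extn T.E Z A) :
    pull T.E (-c) δ = -pull T.E c δ := by
  have := T.additive_left
  simp [pull, Functor.map_neg]

section Exactness

variable {A B Z : C} {x : A ⟶ B} {y : B ⟶ Z} {δ : Extn T.E Z A} (h : T.s δ = sqClass x y)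
include h

theorem comp_eq_zero : x ≫ y = 0 := by
  obtain ⟨c, hc, -⟩ := T.et3 (T.s_zero_id A) h (𝟙 A) x rfl
  simpa using hc.symm

theorem push_inflation : push T.E x δ = 0 := by
  obtain ⟨c, -, hc⟩ := T.et3 h (T.s_zero_id B) x (𝟙 B) rfl
  rw [hc, pull_zero]

theorem pull_deflation : pull T.E y δ = 0 := by
  obtain ⟨a, -, ha⟩ := T.et3op (T.s_zero_id' B) h (𝟙 B) y rfl
  rw [← ha, push_zero]

theorem lift_inflation {W : C} (f : W ⟶ B) (hf : f ≫ y = 0) : ∃ g : W ⟶ A, g ≫ x = f := by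
  obtain ⟨a, ha, -⟩ := T.et3op (T.s_zero_id W) h f 0 (by simp [hf])
  exact ⟨a, by simpa using ha.symm⟩

theorem desc_deflation {W : C} (f : B ⟶ W) (hf : x ≫ f = 0) : ∃ g : Z ⟶ W, y ≫ g = f := by
  obtain ⟨c, hc, -⟩ := T.et3 h (T.s_zero_id' W) 0 f (by simp [hf])
  exact ⟨c, by simpa using hc⟩

theorem lift_deflation {W : C} (c : W ⟶ Z) (hc : pull T.E c δ = 0) :
    ∃ g : W ⟶ B, g ≫ y = c := by
  obtain ⟨b, -, hb⟩ := T.realization (T.s_zero_id' W) h 0 c (by rw [hc, push_zero])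
  exact ⟨b, by simpa using hb.symm⟩

theorem desc_inflation {W : C} (a : A ⟶ W) (ha : push T.E a δ = 0) :
    ∃ g : B ⟶ W, x ≫ g = a := by
  obtain ⟨b, hb, -⟩ := T.realization h (T.s_zero_id W) a 0 (by rw [ha, pull_zero])
  exact ⟨b, by simpa using hb⟩

theorem pull_eq_zero_of_lift {W : C} {c : W ⟶ Z} (g : W ⟶ B) (hg : g ≫ y = c) :
    pull T.E c δ = 0 := by
  rw [← hg, pull_comp, pull_deflation h, pull_zero]

theorem push_eq_zero_of_desc {W : C} {a : A ⟶ W} (g : B ⟶ W) (hg : x ≫ g = a) :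
    push T.E a δ = 0 := by
  rw [← hg, push_comp, push_inflation h, push_zero]

end Exactness

/-- Exactness in the middle is automatic, and the obstruction to extending `m` along the inflation
is the pushforward of the extension. -/
theorem Triangle.contraExact_iff {X : ObjectProperty C} (t : T.Triangle) :
    t.ContraExact X ↔ ∀ M : C, X M → ∀ m : t.A ⟶ M, push T.E m t.δ = 0 := by
  refine ⟨fun h M hM m => ?_, fun h M hM => ⟨fun f => ⟨fun hf => ?_, ?_⟩, fun m => ?_⟩⟩
  · obtain ⟨g, hg⟩ := (h M hM).2 m
    exact push_eq_zero_of_desc t.realizes g hg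
  · exact desc_deflation t.realizes f hf
  · rintro ⟨g, rfl⟩
    change t.x ≫ t.y ≫ g = 0
    rw [← Category.assoc, comp_eq_zero t.realizes, zero_comp]
  · exact desc_inflation t.realizes m (h M hM m)

theorem Triangle.covExact_iff {X : ObjectProperty C} (t : T.Triangle) :
    t.CovExact X ↔ ∀ M : C, X M → ∀ m : M ⟶ t.Z, pull T.E m t.δ = 0 := by
  refine ⟨fun h M hM m => ?_, fun h M hM => ⟨fun f => ⟨fun hf => ?_, ?_⟩, fun m => ?_⟩⟩
  · obtain ⟨g, hg⟩ := (h M hM).2 m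
    exact pull_eq_zero_of_lift t.realizes g hg
  · exact lift_inflation t.realizes f hf
  · rintro ⟨g, rfl⟩
    change (g ≫ t.x) ≫ t.y = 0
    rw [Category.assoc, comp_eq_zero t.realizes, comp_zero]
  · exact lift_deflation t.realizes m (h M hM m)

/-- The sequence `A ⟶ A ⊞ H ⟶ H` attached to the graph of `f : A ⟶ H` splits. -/
theorem s_zero_graph {A H : C} (f : A ⟶ H) :
    T.s (0 : Extn T.E H A) = sqClass (biprod.lift (𝟙 A) f) (biprod.desc (-f) (𝟙 H)) := by
  rw [T.s_zero]
  refine sqClass_eq ⟨biprod.desc (biprod.lift (𝟙 A) f) biprod.inr,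
    biprod.desc (biprod.lift (𝟙 A) (-f)) biprod.inr, ?_, ?_⟩ (by simp) ?_
  all_goals ext <;> simp

/-- The sequence `H ⟶ Z ⊞ H ⟶ Z` attached to the graph of `f : H ⟶ Z` splits. -/
theorem s_zero_cograph {H Z : C} (f : H ⟶ Z) :
    T.s (0 : Extn T.E Z H) = sqClass (biprod.lift (-f) (𝟙 H)) (biprod.desc (𝟙 Z) f) := by
  rw [T.s_zero]
  refine sqClass_eq ⟨biprod.desc (biprod.lift (-f) (𝟙 H)) biprod.inl,
    biprod.desc biprod.inr (biprod.lift (𝟙 H) f), ?_, ?_⟩ (by simp) ?_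
  all_goals ext <;> simp

/-- If `x` is an inflation, then so is `(x, f)`, and the cone of the latter is an extension of
the cone of `x` by the target of `f`. -/
theorem exists_lift_inflation {A B Z H : C} {x : A ⟶ B} {y : B ⟶ Z} {δ : Extn T.E Z A}
    (h : T.s δ = sqClass x y) (f : A ⟶ H) :
    ∃ (F : C) (e : B ⊞ H ⟶ F) (δ' : Extn T.E F A), T.s δ' = sqClass (biprod.lift x f) e ∧
      (∀ (L : C) (i : H ⟶ L), push T.E (f ≫ i) δ = 0 → ∃ j : F ⟶ L, biprod.inr ≫ e ≫ j = i) ∧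
      ∀ (L : C) (u : F ⟶ L), biprod.inr ≫ e ≫ u = 0 →
        ∃ (k : F ⟶ Z) (r : Z ⟶ L), u = k ≫ r := by
  -- The map `(x, f)` is the graph of `f` followed by `x ⊕ 𝟙`. By (ET4) its cone `F` sits in a
  -- triangle `H ⟶ F ⟶ Z ⊞ 0`.
  obtain ⟨F, d, e, h', δ', h₁, h₂, h₃, h₄, -, -⟩ :=
    T.et4 (s_zero_graph f) (T.s_dsum h (T.s_zero_id H))
  have hd : biprod.inr ≫ h' = d := by
    have := congrArg (fun k => biprod.inr ≫ k) h₂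
    simpa using this
  have hx : biprod.lift (𝟙 A) f ≫ biprod.map x (𝟙 H) = biprod.lift x f := by
    ext <;> simp
  rw [hx] at h₁
  refine ⟨F, h', δ', h₁, fun L i hi => ?_, fun L u hu => ?_⟩
  · obtain ⟨j, hj⟩ := desc_inflation h₄ i (by
      rw [← push_comp, dsum, push_add, push_pull, push_pull, ← push_comp, push_zero, push_zero,
        pull_zero, add_zero]
      simp [push_neg_hom, hi]
      exact pull_zero _)
    exact ⟨j, by rw [← Category.assoc, hd, hj]⟩
  · obtain ⟨r, hr⟩ := desc_deflation h₄ u (by rw [← hd, Category.assoc, hu])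
    refine ⟨e ≫ biprod.fst, biprod.inl ≫ r, ?_⟩
    have : (biprod.fst ≫ biprod.inl : Z ⊞ (0 : C) ⟶ _) = 𝟙 _ := by ext; simp
    rw [← hr, Category.assoc, reassoc_of% this]

/-- If `y` is a deflation, then so is `(y, f)`, and the cocone of the latter is an extension of
the source of `f` by the cocone of `y`. -/
theorem exists_desc_deflation {A B Z H : C} {x : A ⟶ B} {y : B ⟶ Z} {δ : Extn T.E Z A}
    (h : T.s δ = sqClass x y) (f : H ⟶ Z) :
    ∃ (K : C) (k : K ⟶ B ⊞ H) (δ' : Extn T.E Z K), T.s δ' = sqClass k (biprod.desc y f) ∧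
      (∀ (L : C) (i : L ⟶ H), pull T.E (i ≫ f) δ = 0 → ∃ j : L ⟶ K, j ≫ k ≫ biprod.snd = i) ∧
      ∀ (L : C) (u : L ⟶ K), u ≫ k ≫ biprod.snd = 0 →
        ∃ (r : L ⟶ A) (c : A ⟶ K), u = r ≫ c := by
  obtain ⟨K, d, e, h', δ', h₁, h₂, h₃, h₄, -, -⟩ :=
    T.et4op (T.s_dsum h (T.s_zero_id' H)) (s_zero_cograph f)
  have he : h' ≫ biprod.snd = e := by
    have := congrArg (fun k => k ≫ biprod.snd) h₃
    simpa using this.symm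
  have hx : biprod.map y (𝟙 H) ≫ biprod.desc (𝟙 Z) f = biprod.desc y f := by
    ext <;> simp
  rw [hx] at h₁
  refine ⟨K, h', δ', h₁, fun L i hi => ?_, fun L u hu => ?_⟩
  · obtain ⟨j, hj⟩ := lift_deflation h₄ i (by
      rw [← pull_comp, dsum, pull_add, ← pull_comp, ← pull_comp, push_zero, pull_zero, add_zero,
        ← push_pull]
      simp [pull_neg_hom, hi]
      exact push_zero _)
    exact ⟨j, by rw [he, hj]⟩
  · obtain ⟨r, hr⟩ := lift_inflation h₄ u (by rw [← he, hu])
    refine ⟨r ≫ biprod.fst, biprod.inl ≫ d, ?_⟩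
    have : (biprod.fst ≫ biprod.inl : A ⊞ (0 : C) ⟶ _) = 𝟙 _ := by ext; simp
    rw [← hr, Category.assoc, reassoc_of% this]

end ExtriangulatedStructure

end Extri

/-! ### Kernels, cokernels and factorizations modulo `X`, expressed in `C`. -/

namespace Extri

section Factoring

variable {C : Type u} [Category.{v} C] {X : ObjectProperty C}

theorem factorsThrough_left {A M B : C} (hM : X M) (i : A ⟶ M) (j : M ⟶ B) :
    FactorsThrough X (i ≫ j) :=
  ⟨M, hM, i, j, rfl⟩

theorem FactorsThrough.comp_right {A B D : C} {f : A ⟶ B} (hf : FactorsThrough X f)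
    (g : B ⟶ D) : FactorsThrough X (f ≫ g) := by
  obtain ⟨M, hM, i, j, rfl⟩ := hf
  exact ⟨M, hM, i, j ≫ g, by simp⟩

theorem FactorsThrough.comp_left {A B D : C} {f : A ⟶ B} (hf : FactorsThrough X f)
    (g : D ⟶ A) : FactorsThrough X (g ≫ f) := by
  obtain ⟨M, hM, i, j, rfl⟩ := hf
  exact ⟨M, hM, g ≫ i, j, by simp⟩

/-- The class of `f` in `C/X` is a monomorphism. -/
def MonoMod (X : ObjectProperty C) {A B : C} (f : A ⟶ B) : Prop :=
  ∀ (W : C) (t : W ⟶ A), FactorsThrough X (t ≫ f) → FactorsThrough X t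

/-- The class of `f` in `C/X` is an epimorphism. -/
def EpiMod (X : ObjectProperty C) {A B : C} (f : A ⟶ B) : Prop :=
  ∀ (W : C) (t : B ⟶ W), FactorsThrough X (f ≫ t) → FactorsThrough X t

/-- The quotient category `C/X` is balanced. -/
def BalancedMod [Preadditive C] (X : ObjectProperty C) : Prop :=
  ∀ (A B : C) (f : A ⟶ B), MonoMod X f → EpiMod X f →
    ∃ r : B ⟶ A, FactorsThrough X (f ≫ r - 𝟙 A) ∧ FactorsThrough X (r ≫ f - 𝟙 B)

end Factoring

namespace ExtriangulatedStructure

namespace IsPseudoClusterTilting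

variable {C : Type u} [Category.{v} C] [Preadditive C] [HasZeroObject C]
  [HasBinaryBiproducts C] {T : ExtriangulatedStructure.{w} C} {X : ObjectProperty C}
  (hX : T.IsPseudoClusterTilting X)
include hX

theorem factorsThrough_of_sub {A B : C} {f g : A ⟶ B} (h : FactorsThrough X (f - g))
    (hg : FactorsThrough X g) : FactorsThrough X f := by
  simpa using hX.factorsThrough_add h hg

theorem factorsThrough_sub {A B : C} {f g : A ⟶ B} (hf : FactorsThrough X f)
    (hg : FactorsThrough X g) : FactorsThrough X (f - g) := by
  rw [sub_eq_add_neg]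
  exact hX.factorsThrough_add hf (factorsThrough_neg hg)

theorem exists_left_approx (A : C) : ∃ (M N : C) (a : A ⟶ M) (b : M ⟶ N) (δ : Extn T.E N A),
    T.s δ = sqClass a b ∧ X M ∧ X N ∧ (∀ L : C, X L → ∀ i : A ⟶ L, ∃ j : M ⟶ L, a ≫ j = i) ∧
    ∀ L : C, X L → ∀ i : A ⟶ L, push T.E i δ = 0 := by
  obtain ⟨M, N, a, b, δ, h, hM, hN, -, ha⟩ := hX.left A
  refine ⟨M, N, a, b, δ, h, hM, hN, fun L hL i => ha L hL i, fun L hL i => ?_⟩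
  obtain ⟨j, hj⟩ := ha L hL i
  exact push_eq_zero_of_desc h j hj

theorem exists_right_approx (A : C) : ∃ (N M : C) (c : N ⟶ M) (d : M ⟶ A) (δ : Extn T.E A N),
    T.s δ = sqClass c d ∧ X N ∧ X M ∧ (∀ L : C, X L → ∀ i : L ⟶ A, ∃ j : L ⟶ M, j ≫ d = i) ∧
    ∀ L : C, X L → ∀ i : L ⟶ A, pull T.E i δ = 0 := by
  obtain ⟨N, M, c, d, δ, h, hN, hM, -, hd⟩ := hX.right A
  refine ⟨N, M, c, d, δ, h, hN, hM, fun L hL i => hd L hL i, fun L hL i => ?_⟩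
  obtain ⟨j, hj⟩ := hd L hL i
  exact pull_eq_zero_of_lift h j hj

/-- Every morphism becomes isomorphic, in `C/X`, to the inflation of an `E`-triangle which is
`C(-, X)`-exact, and whose deflation is a cokernel in `C/X`. -/
theorem exists_inflation {D H : C} (f : D ⟶ H) :
    ∃ (M F : C) (a : D ⟶ M) (e : M ⊞ H ⟶ F) (δ : Extn T.E F D), X M ∧
      T.s δ = sqClass (biprod.lift a f) e ∧ (∀ L : C, X L → ∀ i : D ⟶ L, push T.E i δ = 0) ∧
      ∀ (W : C) (u : F ⟶ W), FactorsThrough X (biprod.inr ≫ e ≫ u) → FactorsThrough X u := by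
  obtain ⟨M, N, a, b, δ, h, hM, hN, ha, ha'⟩ := hX.exists_left_approx D
  obtain ⟨F, e, δ', h', h₁, h₂⟩ := exists_lift_inflation h f
  refine ⟨M, F, a, e, δ', hM, h', fun L hL i => ?_, fun W u => ?_⟩
  · obtain ⟨j, rfl⟩ := ha L hL i
    exact push_eq_zero_of_desc h' (biprod.fst ≫ j) (by simp)
  · rintro ⟨L, hL, i, j, hij⟩
    obtain ⟨i', hi'⟩ := h₁ L i (ha' L hL _)
    obtain ⟨k, r, hk⟩ := h₂ W (u - i' ≫ j) (by
      simp only [Preadditive.comp_sub, reassoc_of% hi', hij, sub_self])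
    exact hX.factorsThrough_of_sub (hk ▸ factorsThrough_left hN k r) (factorsThrough_left hL i' j)

/-- Every morphism becomes isomorphic, in `C/X`, to the deflation of an `E`-triangle which is
`C(X, -)`-exact, and whose inflation is a kernel in `C/X`. -/
theorem exists_deflation {H D : C} (f : H ⟶ D) :
    ∃ (M K : C) (p : M ⟶ D) (k : K ⟶ M ⊞ H) (δ : Extn T.E D K), X M ∧
      T.s δ = sqClass k (biprod.desc p f) ∧ (∀ L : C, X L → ∀ i : L ⟶ D, pull T.E i δ = 0) ∧
      ∀ (W : C) (u : W ⟶ K), FactorsThrough X (u ≫ k ≫ biprod.snd) → FactorsThrough X u := by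
  obtain ⟨N, M, c, p, δ, h, hN, hM, hp, hp'⟩ := hX.exists_right_approx D
  obtain ⟨K, k, δ', h', h₁, h₂⟩ := exists_desc_deflation h f
  refine ⟨M, K, p, k, δ', hM, h', fun L hL i => ?_, fun W u => ?_⟩
  · obtain ⟨j, rfl⟩ := hp L hL i
    exact pull_eq_zero_of_lift h' (j ≫ biprod.inl) (by simp)
  · rintro ⟨L, hL, i, j, hij⟩
    obtain ⟨j', hj'⟩ := h₁ L j (hp' L hL _)
    obtain ⟨r, c, hk⟩ := h₂ W (u - i ≫ j') (by
      simp only [Preadditive.sub_comp, Category.assoc, hj', hij, sub_self])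
    exact hX.factorsThrough_of_sub (hk ▸ factorsThrough_left hN r c) (factorsThrough_left hL i j')

/-- The cone of `(a, f)` works, since `M` vanishes in `C/X`. If `f ≫ t` factors through `L` in `X`,
its first factor extends along `(a, f)`; after subtracting this correction, `t` descends to the
cone. -/
theorem exists_cokernel {D H : C} (f : D ⟶ H) :
    ∃ (F : C) (c : H ⟶ F), FactorsThrough X (f ≫ c) ∧ EpiMod X c ∧
      ∀ (W : C) (t : H ⟶ W), FactorsThrough X (f ≫ t) →
        ∃ u : F ⟶ W, FactorsThrough X (c ≫ u - t) := by
  obtain ⟨M, F, a, e, δ, hM, h, h₁, h₂⟩ := hX.exists_inflation f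
  have h₀ := comp_eq_zero h
  refine ⟨F, biprod.inr ≫ e, ?_, fun W t ht => h₂ W t (by simpa using ht), ?_⟩
  · have : f ≫ biprod.inr ≫ e = -(a ≫ biprod.inl ≫ e) := by
      rw [eq_neg_iff_add_eq_zero, ← h₀, biprod.lift_eq]
      simp [add_comm]
    rw [this]
    exact factorsThrough_neg (factorsThrough_left hM _ _)
  · rintro W t ⟨L, hL, i, j, hij⟩
    obtain ⟨g, hg⟩ := desc_inflation h i (h₁ L hL i)
    obtain ⟨u, hu⟩ := desc_deflation h (biprod.snd ≫ t - g ≫ j) (by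
      rw [Preadditive.comp_sub, reassoc_of% hg, biprod.lift_snd_assoc, hij, sub_self])
    refine ⟨u, ?_⟩
    have : (biprod.inr ≫ e) ≫ u - t = -((biprod.inr ≫ g) ≫ j) := by
      rw [Category.assoc, hu]
      simp
    rw [this]
    exact factorsThrough_neg (factorsThrough_left hL _ _)

theorem exists_kernel {H D : C} (f : H ⟶ D) :
    ∃ (K : C) (c : K ⟶ H), FactorsThrough X (c ≫ f) ∧ MonoMod X c ∧
      ∀ (W : C) (t : W ⟶ H), FactorsThrough X (t ≫ f) →
        ∃ u : W ⟶ K, FactorsThrough X (u ≫ c - t) := by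
  obtain ⟨M, K, p, k, δ, hM, h, h₁, h₂⟩ := hX.exists_deflation f
  have h₀ := comp_eq_zero h
  refine ⟨K, k ≫ biprod.snd, ?_, h₂, ?_⟩
  · have : (k ≫ biprod.snd) ≫ f = -((k ≫ biprod.fst) ≫ p) := by
      rw [eq_neg_iff_add_eq_zero, ← h₀, biprod.desc_eq]
      simp [add_comm]
    rw [this]
    exact factorsThrough_neg (factorsThrough_left hM _ _)
  · rintro W t ⟨L, hL, i, j, hij⟩
    obtain ⟨g, hg⟩ := lift_deflation h j (h₁ L hL j)
    obtain ⟨u, hu⟩ := lift_inflation h (t ≫ biprod.inr - i ≫ g) (by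
      rw [Preadditive.sub_comp, Category.assoc, Category.assoc, hg, biprod.inr_desc, hij,
        sub_self])
    refine ⟨u, ?_⟩
    have : u ≫ k ≫ biprod.snd - t = -(i ≫ g ≫ biprod.snd) := by
      rw [reassoc_of% hu]
      simp
    rw [this]
    exact factorsThrough_neg (factorsThrough_left hL _ _)

/-- Every morphism is, in `C/X`, an epimorphism followed by a weak kernel of a morphism which it
annihilates. -/
theorem exists_epi_comp_weakKernel {D H : C} (f : D ⟶ H) :
    ∃ (I F : C) (i : D ⟶ I) (q : I ⟶ H) (c : H ⟶ F), i ≫ q = f ∧ EpiMod X i ∧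
      FactorsThrough X (q ≫ c) ∧
      ∀ (W : C) (t : W ⟶ H), FactorsThrough X (t ≫ c) →
        ∃ l : W ⟶ I, FactorsThrough X (l ≫ q - t) := by
  obtain ⟨M, F, a, e, δ, hM, h, h₁, -⟩ := hX.exists_inflation f
  obtain ⟨-, P, -, p, -, -, -, hP, hp, -⟩ := hX.exists_right_approx F
  -- Pulling back along a right approximation `P` of the cone makes the third term lie in `X`, which
  -- makes `i` epi modulo `X`; maps from `X` to `F` still lift to `P`, which gives the weak kernel
  -- property.
  obtain ⟨I, i, π, hI⟩ := T.exists_realization (pull T.E p δ)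
  obtain ⟨q, hq₁, hq₂⟩ := T.realization hI h (𝟙 D) p (push_id _)
  rw [Category.id_comp] at hq₁
  refine ⟨I, F, i, q ≫ biprod.snd, biprod.inr ≫ e, by simp [reassoc_of% hq₁], ?_, ?_, ?_⟩
  · rintro W t ⟨L, hL, r, j, hrj⟩
    obtain ⟨r', hr'⟩ := desc_inflation hI r (by rw [push_pull, h₁ L hL, pull_zero])
    obtain ⟨s, hs⟩ := desc_deflation hI (t - r' ≫ j) (by
      rw [Preadditive.comp_sub, reassoc_of% hr', hrj, sub_self])
    exact hX.factorsThrough_of_sub (hs ▸ factorsThrough_left hP π s) (factorsThrough_left hL r' j)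
  · have : (q ≫ biprod.snd) ≫ biprod.inr ≫ e = π ≫ p - (q ≫ biprod.fst) ≫ biprod.inl ≫ e := by
      have h' : q = (q ≫ biprod.fst) ≫ biprod.inl + (q ≫ biprod.snd) ≫ biprod.inr := by
        rw [Category.assoc, Category.assoc, ← Preadditive.comp_add, biprod.total, Category.comp_id]
      rw [hq₂, eq_sub_iff_add_eq, add_comm]
      conv_rhs => rw [h']
      simp
    rw [this]
    exact hX.factorsThrough_sub (factorsThrough_left hP _ _) (factorsThrough_left hM _ _)
  · rintro W t ⟨L, hL, r, j, hrj⟩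
    obtain ⟨j', rfl⟩ := hp L hL j
    obtain ⟨l, hl⟩ := lift_deflation hI (r ≫ j') (by
      rw [← pull_comp]
      refine pull_eq_zero_of_lift h (t ≫ biprod.inr) ?_
      rw [Category.assoc, Category.assoc, hrj])
    obtain ⟨s, hs⟩ := lift_inflation h (t ≫ biprod.inr - l ≫ q) (by
      rw [Preadditive.sub_comp, Category.assoc, Category.assoc, ← hq₂,
        reassoc_of% hl, hrj, sub_self])
    refine ⟨l + s ≫ i, ?_⟩
    have : (l + s ≫ i) ≫ q ≫ biprod.snd - t = 0 := by
      have := congrArg (fun k => k ≫ biprod.snd) (hq₁ ▸ hs)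
      simp only [Preadditive.sub_comp, Category.assoc, biprod.inr_snd, Category.comp_id] at this
      rw [Preadditive.add_comp, Category.assoc, this]
      abel
    rw [this]
    exact hX.factorsThrough_zero _ _

/-- Every morphism is, in `C/X`, a weak cokernel of a morphism by which it is annihilated,
followed by a monomorphism. -/
theorem exists_weakCokernel_comp_mono {H D : C} (f : H ⟶ D) :
    ∃ (I K : C) (i : I ⟶ D) (q : H ⟶ I) (c : K ⟶ H), q ≫ i = f ∧ MonoMod X i ∧
      FactorsThrough X (c ≫ q) ∧
      ∀ (W : C) (t : H ⟶ W), FactorsThrough X (c ≫ t) →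
        ∃ l : I ⟶ W, FactorsThrough X (q ≫ l - t) := by
  obtain ⟨M, K, p, k, δ, hM, h, h₁, -⟩ := hX.exists_deflation f
  obtain ⟨P, -, a, -, -, -, hP, -, ha, -⟩ := hX.exists_left_approx K
  -- Dually, pushing out along a left approximation of the cocone puts the first term in `X`.
  obtain ⟨I, ν, i, hI⟩ := T.exists_realization (push T.E a δ)
  obtain ⟨q, hq₁, hq₂⟩ := T.realization h hI a (𝟙 D) (pull_id _).symm
  rw [Category.comp_id] at hq₂
  refine ⟨I, K, i, biprod.inr ≫ q, k ≫ biprod.snd, by simp [← hq₂], ?_, ?_, ?_⟩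
  · rintro W t ⟨L, hL, r, j, hrj⟩
    obtain ⟨j', hj'⟩ := lift_deflation hI j (by rw [← push_pull, h₁ L hL, push_zero])
    obtain ⟨s, hs⟩ := lift_inflation hI (t - r ≫ j') (by
      rw [Preadditive.sub_comp, Category.assoc, hj', hrj, sub_self])
    exact hX.factorsThrough_of_sub (hs ▸ factorsThrough_left hP s ν) (factorsThrough_left hL r j')
  · have : (k ≫ biprod.snd) ≫ biprod.inr ≫ q = a ≫ ν - (k ≫ biprod.fst) ≫ biprod.inl ≫ q := by
      have h' : k = (k ≫ biprod.fst) ≫ biprod.inl + (k ≫ biprod.snd) ≫ biprod.inr := by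
        rw [Category.assoc, Category.assoc, ← Preadditive.comp_add, biprod.total, Category.comp_id]
      rw [← hq₁, eq_sub_iff_add_eq, add_comm]
      conv_rhs => rw [h']
      simp
    rw [this]
    exact hX.factorsThrough_sub (factorsThrough_left hP _ _) (factorsThrough_left hM _ _)
  · rintro W t ⟨L, hL, r, j, hrj⟩
    obtain ⟨r', rfl⟩ := ha L hL r
    obtain ⟨l, hl⟩ := desc_inflation hI (r' ≫ j) (by
      rw [← push_comp]
      refine push_eq_zero_of_desc h (biprod.snd ≫ t) ?_
      rw [← Category.assoc, hrj, Category.assoc])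
    obtain ⟨s, hs⟩ := desc_deflation h (biprod.snd ≫ t - q ≫ l) (by
      rw [Preadditive.comp_sub, reassoc_of% hq₁, hl, ← Category.assoc, hrj, Category.assoc,
        sub_self])
    refine ⟨l + i ≫ s, ?_⟩
    have : (biprod.inr ≫ q) ≫ (l + i ≫ s) - t = 0 := by
      have := congrArg (fun k => biprod.inr ≫ k) (hq₂ ▸ hs)
      simp only [Preadditive.comp_sub, Category.assoc, biprod.inr_snd_assoc] at this
      rw [Preadditive.comp_add, Category.assoc, Category.assoc, this]
      abel
    rw [this]
    exact hX.factorsThrough_zero _ _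

end IsPseudoClusterTilting

end ExtriangulatedStructure

end Extri

/-! ### Balancedness and self-orthogonality. -/

namespace Extri

namespace ExtriangulatedStructure

namespace IsPseudoClusterTilting

variable {C : Type u} [Category.{v} C] [Preadditive C] [HasZeroObject C]
  [HasBinaryBiproducts C] {T : ExtriangulatedStructure.{w} C} {X : ObjectProperty C}
  (hX : T.IsPseudoClusterTilting X)
include hX

theorem selfOrthogonal_classS (hb : BalancedMod X) : T.SelfOrthogonal X (T.classS X) := by
  rintro _ ⟨Δ, rfl, h₂, h₁⟩ (hB : X Δ.B) (hF : X Δ.F)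
  rw [Triangle.covExact_iff] at h₂
  rw [Triangle.contraExact_iff] at h₁
  have hmono : MonoMod X Δ.d := by
    rintro W t ⟨M, hM, i, j, hij⟩
    -- The obstruction to lifting `t` to `B`, which lies in `X`, is `t^* d^* δh = i^* j^* δh`, and
    -- `j^* δh` vanishes by exactness of the lower row.
    obtain ⟨g, rfl⟩ := lift_deflation Δ.real_f t (by
      rw [Δ.row_ext, ← pull_comp, hij, pull_comp]
      exact (congrArg _ (h₂ M hM j)).trans (pull_zero i))
    exact factorsThrough_left hB _ _
  have hepi : EpiMod X Δ.d := by
    rintro W t ⟨M, hM, i, j, hij⟩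
    obtain ⟨i', hi'⟩ := desc_inflation Δ.real_d i (h₁ M hM i)
    obtain ⟨k, hk⟩ := desc_deflation Δ.real_d (t - i' ≫ j) (by
      rw [Preadditive.comp_sub, reassoc_of% hi', hij, sub_self])
    exact hX.factorsThrough_of_sub (hk ▸ factorsThrough_left hF _ _)
      (factorsThrough_left hM i' j)
  obtain ⟨r, ⟨M, hM, i, j, hij⟩, -⟩ := hb _ _ Δ.d hmono hepi
  obtain ⟨i', hi'⟩ := desc_inflation Δ.real_d i (h₁ M hM i)
  -- The inverse modulo `X` is corrected to a genuine retraction of `d`.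
  have hδ : push T.E (𝟙 _) Δ.δd = 0 := push_eq_zero_of_desc Δ.real_d (r - i' ≫ j) (by
    rw [Preadditive.comp_sub, reassoc_of% hi', ← hij, sub_sub_cancel])
  rw [push_id] at hδ
  obtain ⟨s, hs⟩ := lift_deflation Δ.real_d (𝟙 _) (by rw [hδ, pull_zero])
  -- Since `F` is in `X`, the section of `e` lifts to `G` and becomes a section of `g'`.
  obtain ⟨s', hs'⟩ := lift_deflation Δ.real_h s (h₂ _ hF s)
  have := pull_eq_zero_of_lift Δ.real_g (c := 𝟙 _) s' (by
    rw [← Δ.comm_right, reassoc_of% hs', hs])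
  rwa [pull_id] at this

theorem selfOrthogonal_classT (hb : BalancedMod X) : T.SelfOrthogonal X (T.classT X) := by
  rintro _ ⟨Δ, rfl, h₁, h₂⟩ (hA : X Δ.A) (hH : X Δ.H)
  rw [Triangle.covExact_iff] at h₂
  rw [Triangle.contraExact_iff] at h₁
  have hepi : EpiMod X Δ.f' := by
    rintro W t ⟨M, hM, i, j, hij⟩
    obtain ⟨g, rfl⟩ := desc_inflation Δ.real_d t (by
      rw [← Δ.col_ext, ← push_comp, hij, push_comp]
      exact (congrArg _ (h₁ M hM i)).trans (push_zero j))
    exact factorsThrough_left hH _ _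
  have hmono : MonoMod X Δ.f' := by
    rintro W t ⟨M, hM, i, j, hij⟩
    obtain ⟨j', hj'⟩ := lift_deflation Δ.real_f j (h₂ M hM j)
    obtain ⟨k, hk⟩ := lift_inflation Δ.real_f (t - i ≫ j') (by
      rw [Preadditive.sub_comp, Category.assoc, hj', hij, sub_self])
    exact hX.factorsThrough_of_sub (hk ▸ factorsThrough_left hA _ _)
      (factorsThrough_left hM i j')
  obtain ⟨r, -, ⟨M, hM, i, j, hij⟩⟩ := hb _ _ Δ.f' hmono hepi
  obtain ⟨j', hj'⟩ := lift_deflation Δ.real_f j (h₂ M hM j)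
  have hδ : pull T.E (𝟙 _) Δ.δf = 0 := pull_eq_zero_of_lift Δ.real_f (r - i ≫ j') (by
    rw [Preadditive.sub_comp, Category.assoc, hj', ← hij, sub_sub_cancel])
  rw [pull_id] at hδ
  obtain ⟨s, hs⟩ := desc_inflation Δ.real_f (𝟙 _) (by rw [hδ, push_zero])
  obtain ⟨s', hs'⟩ := desc_inflation Δ.real_g s (h₁ _ hA s)
  have := push_eq_zero_of_desc Δ.real_h (a := 𝟙 _) s' (by
    rw [← Δ.comm_left, Category.assoc, hs', hs])
  rwa [push_id] at this

/-- The extension is shown to be `p_*` of an extension of `F` by `M`, for a right approximation `p :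
M ⟶ D`. The latter has both ends in `X` and lies in `S`, hence vanishes. -/
theorem eq_zero_of_monoMod (hS : T.SelfOrthogonal X (T.classS X)) {D H F : C} {d : D ⟶ H}
    {e : H ⟶ F} {δ : Extn T.E F D} (h : T.s δ = sqClass d e) (hF : X F)
    (hδ : ∀ L : C, X L → ∀ i : D ⟶ L, push T.E i δ = 0) (hd : MonoMod X d) : δ = 0 := by
  obtain ⟨N₀, M₀, c₀, p₀, δ₀, h₀, -, hM₀, hp₀, -⟩ := hX.exists_right_approx H
  obtain ⟨B₀, d₀, e₀, h', δ₁, h₁, -, h₃, -, h₅, -⟩ := T.et4op h₀ h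
  -- Here `δ = e₀_* δ₁`, and `e₀ ≫ d` factors through `M₀`. As `d` is mono modulo `X`, so `e₀`
  -- factors through `X`, and therefore through `p`.
  obtain ⟨M₁, hM₁, u, v, he₀⟩ := hd B₀ e₀ ⟨M₀, hM₀, h', p₀, h₃⟩
  obtain ⟨A, M, c, p, δA, hA, -, hM, hp, -⟩ := hX.exists_right_approx D
  obtain ⟨v', rfl⟩ := hp M₁ hM₁ v
  have hδ₁ : push T.E p (push T.E (u ≫ v') δ₁) = δ := by
    rw [← push_comp, Category.assoc, ← he₀, h₅]
  obtain ⟨G, g, g', hg⟩ := T.exists_realization (push T.E (u ≫ v') δ₁)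
  obtain ⟨H', d', e', h'', δh, k₁, k₂, k₃, k₄, k₅, -⟩ := T.et4 hA hg
  let Δ : T.Diagram :=
    { A := A, B := M, D := D, G := G, H := H', F := F
      f := c, f' := p, h := c ≫ g, h' := h'', g := g, g' := g', d := d', e := e'
      δf := δA, δh := δh, δg := push T.E (u ≫ v') δ₁
      δd := push T.E p (push T.E (u ≫ v') δ₁)
      real_f := hA, real_h := k₁, real_g := hg, real_d := k₄
      comm_left := rfl, comm_sq := k₂.symm, comm_right := k₃
      row_ext := k₅.symm, col_ext := rfl }
  have hcontra : Δ.col₂.ContraExact X := by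
    rw [Triangle.contraExact_iff]
    intro L hL i
    exact (congrArg _ hδ₁).trans (hδ L hL i)
  have hcov : Δ.row₂.CovExact X := by
    rw [Triangle.covExact_iff]
    intro L hL (m : L ⟶ H')
    change pull T.E m δh = 0
    -- The right column realizes `δ`, so `H'` is identified with `H`. There `m` lifts to `M₀`, which
    -- kills the obstruction to lifting `m ≫ e'` to `G`; the remaining difference comes from `D`,
    -- hence from `M`.
    obtain ⟨φ, hφ₁, hφ₂⟩ := exists_iso_of_sqClass_eq (h.symm.trans (hδ₁ ▸ k₄))
    obtain ⟨l, hl⟩ := hp₀ L hL (m ≫ φ.inv)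
    obtain ⟨k, hk⟩ := lift_deflation hg (m ≫ e') (by
      rw [← push_pull, pull_eq_zero_of_lift h₁ l (by rw [reassoc_of% hl, ← hφ₂]; simp),
        push_zero])
    obtain ⟨n, hn⟩ := lift_inflation k₄ (m - k ≫ h'') (by
      rw [Preadditive.sub_comp, Category.assoc, k₃, hk, sub_self])
    obtain ⟨n', rfl⟩ := hp L hL n
    refine pull_eq_zero_of_lift k₁ (k + n' ≫ g) ?_
    rw [Preadditive.add_comp, Category.assoc, k₂, ← Category.assoc n', hn, add_sub_cancel]
  have : push T.E (u ≫ v') δ₁ = 0 := hS Δ.col₁ ⟨Δ, rfl, hcov, hcontra⟩ hM hF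
  rw [← hδ₁, this, push_zero]

/-- Dually, the extension is `a^*` of an extension of `M` by `A`, for a left approximation `a : D ⟶
M`, and the latter is the lower row of a diagram defining `T`. -/
theorem eq_zero_of_epiMod (hT : T.SelfOrthogonal X (T.classT X)) {A B D : C} {f : A ⟶ B}
    {f' : B ⟶ D} {δ : Extn T.E D A} (h : T.s δ = sqClass f f') (hA : X A)
    (hδ : ∀ L : C, X L → ∀ i : L ⟶ D, pull T.E i δ = 0) (hf' : EpiMod X f') : δ = 0 := by
  obtain ⟨M₀, N₀, a₀, b₀, δ₀, h₀, hM₀, -, ha₀, -⟩ := hX.exists_left_approx B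
  obtain ⟨H₀, d₀, e₀, h', δ₁, h₁, h₂, -, -, h₅, -⟩ := T.et4 h h₀
  obtain ⟨M₁, hM₁, u, v, hd₀⟩ := hf' H₀ d₀ ⟨M₀, hM₀, a₀, h', h₂.symm⟩
  obtain ⟨M, N, a, b, δD, hD, hM, -, ha, -⟩ := hX.exists_left_approx D
  obtain ⟨u', rfl⟩ := ha M₁ hM₁ u
  have hδ₁ : pull T.E a (pull T.E (u' ≫ v) δ₁) = δ := by
    rw [← pull_comp, ← Category.assoc, ← hd₀, h₅]
  obtain ⟨G, g, g', hg⟩ := T.exists_realization (pull T.E (u' ≫ v) δ₁)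
  obtain ⟨B', d', e', h'', δh, k₁, k₂, k₃, k₄, k₅, -⟩ := T.et4op hg hD
  let Δ : T.Diagram :=
    { A := A, B := B', D := D, G := G, H := M, F := N
      f := d', f' := e', h := g, h' := g', g := h'', g' := g' ≫ b, d := a, e := b
      δf := pull T.E a (pull T.E (u' ≫ v) δ₁), δh := pull T.E (u' ≫ v) δ₁, δg := δh
      δd := δD
      real_f := k₄, real_h := hg, real_g := k₁, real_d := hD
      comm_left := k₂, comm_sq := k₃, comm_right := rfl
      row_ext := rfl, col_ext := k₅ }
  have hcov : Δ.row₁.CovExact X := by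
    rw [Triangle.covExact_iff]
    intro L hL i
    exact (congrArg _ hδ₁).trans (hδ L hL i)
  have hcontra : Δ.col₁.ContraExact X := by
    rw [Triangle.contraExact_iff]
    intro L hL (m : B' ⟶ L)
    change push T.E m δh = 0
    obtain ⟨φ, hφ₁, hφ₂⟩ := exists_iso_of_sqClass_eq (h.symm.trans (hδ₁ ▸ k₄))
    obtain ⟨l, hl⟩ := ha₀ L hL (φ.hom ≫ m)
    obtain ⟨k, hk⟩ := desc_inflation hg (d' ≫ m) (by
      rw [push_pull, push_eq_zero_of_desc h₁ l (by
        rw [Category.assoc, hl, reassoc_of% hφ₁]), pull_zero])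
    obtain ⟨n, hn⟩ := desc_deflation k₄ (m - h'' ≫ k) (by
      rw [Preadditive.comp_sub, reassoc_of% k₂, hk, sub_self])
    obtain ⟨n', rfl⟩ := ha L hL n
    refine push_eq_zero_of_desc k₁ (k + g' ≫ n') ?_
    rw [Preadditive.comp_add, ← reassoc_of% k₃, hn, add_sub_cancel]
  have : pull T.E (u' ≫ v) δ₁ = 0 := hT Δ.row₂ ⟨Δ, rfl, hcontra, hcov⟩ hA hM
  rw [← hδ₁, this, pull_zero]

theorem balancedMod_of_classS (hS : T.SelfOrthogonal X (T.classS X)) : BalancedMod X := by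
  intro D H f hmono hepi
  obtain ⟨M, F, a, e, δ, hM, h, h₁, h₂⟩ := hX.exists_inflation f
  have hd : MonoMod X (biprod.lift a f) := fun W t ht =>
    hmono W t (by simpa using ht.comp_right biprod.snd)
  -- The composite `f ≫ biprod.inr ≫ e` factors through `M`, so `f` being epi handles the component
  -- of `e` on `H`; the other one starts at `M`.
  have he : FactorsThrough X e := by
    have h₀ : FactorsThrough X (biprod.inr ≫ e) := by
      refine hepi _ _ ?_
      have : f ≫ biprod.inr ≫ e = -(a ≫ biprod.inl ≫ e) := by
        rw [eq_neg_iff_add_eq_zero, ← comp_eq_zero h, biprod.lift_eq]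
        simp [add_comm]
      rw [this]
      exact factorsThrough_neg (factorsThrough_left hM _ _)
    have : e = biprod.fst ≫ biprod.inl ≫ e + biprod.snd ≫ biprod.inr ≫ e := by
      simp [← Category.assoc, ← Preadditive.add_comp]
    rw [this]
    exact hX.factorsThrough_add
      (by rw [← Category.assoc]; exact (factorsThrough_left hM _ _).comp_right e)
      (h₀.comp_left _)
  obtain ⟨L, hL, i, j, hij⟩ := he
  -- The pullback has third term `L` in `X`, and its inflation stays mono modulo `X` because `(a,
  -- f)` factors through it.
  obtain ⟨H₁, d₁, e₁, hH₁⟩ := T.exists_realization (pull T.E j δ)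
  obtain ⟨q, hq, -⟩ := T.realization hH₁ h (𝟙 D) j (push_id _)
  rw [Category.id_comp] at hq
  have hδ := hX.eq_zero_of_monoMod hS hH₁ hL
    (fun L' hL' i' => by rw [push_pull, h₁ L' hL', pull_zero])
    (fun W t ht => hd W t (by rw [← hq, ← Category.assoc]; exact ht.comp_right q))
  -- The vanishing makes `j` lift along `e`, so `𝟙 - i ≫ t` is killed by `e` and factors through
  -- `(a, f)`. The component of that factorization at `H` is the inverse modulo `X`.
  obtain ⟨t, ht⟩ := lift_deflation h j hδ
  obtain ⟨s, hs⟩ := lift_inflation h (𝟙 _ - i ≫ t) (by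
    rw [Preadditive.sub_comp, Category.assoc, ht, ← hij, Category.id_comp, sub_self])
  have hr : FactorsThrough X ((biprod.inr ≫ s) ≫ f - 𝟙 H) := by
    have := congrArg (fun k => biprod.inr ≫ k ≫ biprod.snd) hs
    simp only [Category.assoc, biprod.lift_snd, Preadditive.sub_comp, Preadditive.comp_sub,
      Category.id_comp, biprod.inr_snd] at this
    rw [Category.assoc, this, sub_sub_cancel_left, ← Category.assoc]
    exact factorsThrough_neg (factorsThrough_left hL _ _)
  refine ⟨biprod.inr ≫ s, hmono _ _ ?_, hr⟩
  -- With `r` the inverse found, `(f ≫ r - 𝟙) ≫ f = f ≫ (r ≫ f - 𝟙)`, and `f` can be cancelled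
  -- modulo `X`.
  simpa [Preadditive.sub_comp, Preadditive.comp_sub] using hr.comp_left f

theorem balancedMod_of_classT (hT : T.SelfOrthogonal X (T.classT X)) : BalancedMod X := by
  intro H D f hmono hepi
  obtain ⟨M, K, p, k, δ, hM, h, h₁, h₂⟩ := hX.exists_deflation f
  have hd : EpiMod X (biprod.desc p f) := fun W t ht =>
    hepi W t (by simpa using ht.comp_left biprod.inr)
  have hk : FactorsThrough X k := by
    have h₀ : FactorsThrough X (k ≫ biprod.snd) := by
      refine hmono _ _ ?_
      have : (k ≫ biprod.snd) ≫ f = -((k ≫ biprod.fst) ≫ p) := by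
        rw [eq_neg_iff_add_eq_zero, ← comp_eq_zero h, biprod.desc_eq]
        simp [add_comm]
      rw [this]
      exact factorsThrough_neg (factorsThrough_left hM _ _)
    have : k = (k ≫ biprod.fst) ≫ biprod.inl + (k ≫ biprod.snd) ≫ biprod.inr := by
      simp [← Preadditive.comp_add]
    rw [this]
    exact hX.factorsThrough_add (factorsThrough_left hM _ _) (h₀.comp_right _)
  obtain ⟨L, hL, i, j, hij⟩ := hk
  obtain ⟨H₁, d₁, e₁, hH₁⟩ := T.exists_realization (push T.E i δ)
  obtain ⟨q, -, hq⟩ := T.realization h hH₁ i (𝟙 D) (pull_id _).symm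
  rw [Category.comp_id] at hq
  have hδ := hX.eq_zero_of_epiMod hT hH₁ hL
    (fun L' hL' i' => by rw [← push_pull, h₁ L' hL', push_zero])
    (fun W t ht => hd W t (by rw [hq, Category.assoc]; exact ht.comp_left q))
  obtain ⟨t, ht⟩ := desc_inflation h i hδ
  obtain ⟨s, hs⟩ := desc_deflation h (𝟙 _ - t ≫ j) (by
    rw [Preadditive.comp_sub, reassoc_of% ht, ← hij, Category.comp_id, sub_self])
  have hr : FactorsThrough X (f ≫ s ≫ biprod.snd - 𝟙 H) := by
    have := congrArg (fun k => biprod.inr ≫ k ≫ biprod.snd) hs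
    simp only [Category.assoc, biprod.inr_desc_assoc, Preadditive.sub_comp, Preadditive.comp_sub,
      Category.id_comp, biprod.inr_snd] at this
    rw [this, sub_sub_cancel_left, ← Category.assoc]
    exact factorsThrough_neg (factorsThrough_left hL _ _)
  refine ⟨s ≫ biprod.snd, hr, hepi _ _ ?_⟩
  simpa [Preadditive.sub_comp, Preadditive.comp_sub] using hr.comp_right f

end IsPseudoClusterTilting

end ExtriangulatedStructure

end Extri

/-! ### Passage to the quotient category `C/X`. -/

namespace Extri

namespace ExtriangulatedStructure

namespace IsPseudoClusterTilting

variable {C : Type u} [Category.{v} C] [Preadditive C] [HasZeroObject C]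
  [HasBinaryBiproducts C] {T : ExtriangulatedStructure.{w} C} {X : ObjectProperty C}

/-- The projection functor from `C` to `C/X`. -/
abbrev proj (X : ObjectProperty C) : C ⥤ ModSub X :=
  CategoryTheory.Quotient.functor (quotRel X)

section Projection

variable (hX : T.IsPseudoClusterTilting X)
include hX

theorem proj_map_eq_iff {A B : C} (f g : A ⟶ B) :
    (proj X).map f = (proj X).map g ↔ FactorsThrough X (f - g) :=
  letI := hX.congruence
  CategoryTheory.Quotient.functor_map_eq_iff (quotRel X) f g

theorem proj_map_eq_zero_iff {A B : C} (f : A ⟶ B) :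
    letI := hX.preadditive
    (proj X).map f = 0 ↔ FactorsThrough X f := by
  have h := hX.proj_map_eq_iff f 0
  rw [sub_zero] at h
  exact h

theorem proj_additive :
    letI := hX.preadditive
    (proj X).Additive :=
  let _ := hX.preadditive
  { map_add := rfl }

theorem mono_proj_map_iff {A B : C} (f : A ⟶ B) :
    Mono ((proj X).map f) ↔ MonoMod X f := by
  let _ := hX.preadditive
  rw [Preadditive.mono_iff_cancel_zero]
  constructor
  · intro h W t ht
    rw [← hX.proj_map_eq_zero_iff] at ht ⊢
    exact h _ _ (by rw [← Functor.map_comp, ht])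
  · rintro h ⟨W⟩ t ht
    obtain ⟨t, rfl⟩ := (proj X).map_surjective (X := W) t
    erw [← Functor.map_comp, hX.proj_map_eq_zero_iff] at ht
    exact (hX.proj_map_eq_zero_iff t).2 (h W t ht)

theorem epi_proj_map_iff {A B : C} (f : A ⟶ B) :
    Epi ((proj X).map f) ↔ EpiMod X f := by
  let _ := hX.preadditive
  rw [Preadditive.epi_iff_cancel_zero]
  constructor
  · intro h W t ht
    rw [← hX.proj_map_eq_zero_iff] at ht ⊢
    exact h _ _ (by rw [← Functor.map_comp, ht])
  · rintro h ⟨W⟩ t ht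
    obtain ⟨t, rfl⟩ := (proj X).map_surjective (Y := W) t
    erw [← Functor.map_comp, hX.proj_map_eq_zero_iff] at ht
    exact (hX.proj_map_eq_zero_iff t).2 (h W t ht)

theorem balanced_iff : Balanced (ModSub X) ↔ BalancedMod X := by
  let _ := hX.preadditive
  constructor
  · intro h A B f hm he
    have := (hX.mono_proj_map_iff f).2 hm
    have := (hX.epi_proj_map_iff f).2 he
    have := isIso_of_mono_of_epi ((proj X).map f)
    obtain ⟨r, hr⟩ := (proj X).map_surjective (inv ((proj X).map f))
    refine ⟨r, ?_, ?_⟩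
    · rw [← hX.proj_map_eq_iff, Functor.map_comp, hr, IsIso.hom_inv_id, CategoryTheory.Functor.map_id]
    · rw [← hX.proj_map_eq_iff, Functor.map_comp, hr, IsIso.inv_hom_id, CategoryTheory.Functor.map_id]
  · refine fun h => ⟨?_⟩
    rintro ⟨A⟩ ⟨B⟩ f hm he
    obtain ⟨f, rfl⟩ := (proj X).map_surjective (X := A) (Y := B) f
    obtain ⟨r, h₁, h₂⟩ := h A B f ((hX.mono_proj_map_iff f).1 hm) ((hX.epi_proj_map_iff f).1 he)
    refine ⟨(proj X).map r, ?_, ?_⟩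
    · exact (Functor.map_comp _ _ _).symm.trans
        (((hX.proj_map_eq_iff _ _).2 h₁).trans ((proj X).map_id A))
    · exact (Functor.map_comp _ _ _).symm.trans
        (((hX.proj_map_eq_iff _ _).2 h₂).trans ((proj X).map_id B))

theorem hasFiniteProducts : HasFiniteProducts (ModSub X) := by
  let _ := hX.preadditive
  have := hX.proj_additive
  have : HasZeroObject (ModSub X) := ⟨_, (proj X).map_isZero (isZero_zero C)⟩
  have : HasBinaryBiproducts (ModSub X) := ⟨by
    rintro ⟨A⟩ ⟨B⟩
    have := preservesBinaryBiproducts_of_preservesBiproducts (proj X)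
    exact Functor.hasBinaryBiproduct_of_preserves (proj X) A B⟩
  exact hasFiniteProducts_of_has_binary_and_terminal

theorem hasKernels :
    letI := hX.preadditive
    HasKernels (ModSub X) := by
  let _ := hX.preadditive
  refine ⟨?_⟩
  rintro ⟨A⟩ ⟨B⟩ f
  obtain ⟨f, rfl⟩ := (proj X).map_surjective (X := A) (Y := B) f
  obtain ⟨K, c, h₁, h₂, h₃⟩ := hX.exists_kernel f
  have hc : (proj X).map c ≫ (proj X).map f = 0 := by
    rwa [← Functor.map_comp, hX.proj_map_eq_zero_iff]
  have := (hX.mono_proj_map_iff c).2 h₂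
  have hl : ∀ {W : ModSub X} (t : W ⟶ (proj X).obj A), t ≫ (proj X).map f = 0 →
      ∃ l, l ≫ (proj X).map c = t := by
    rintro ⟨W⟩ t ht
    obtain ⟨t, rfl⟩ := (proj X).map_surjective (X := W) t
    obtain ⟨l, hl⟩ := h₃ W t (by
      rw [← hX.proj_map_eq_zero_iff, Functor.map_comp]
      exact ht)
    exact ⟨(proj X).map l, (Functor.map_comp _ _ _).symm.trans ((hX.proj_map_eq_iff _ _).2 hl)⟩
  exact ⟨⟨_, KernelFork.IsLimit.ofι' _ hc fun t ht => ⟨_, (hl t ht).choose_spec⟩⟩⟩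

theorem hasCokernels :
    letI := hX.preadditive
    HasCokernels (ModSub X) := by
  let _ := hX.preadditive
  refine ⟨?_⟩
  rintro ⟨A⟩ ⟨B⟩ f
  obtain ⟨f, rfl⟩ := (proj X).map_surjective (X := A) (Y := B) f
  obtain ⟨K, c, h₁, h₂, h₃⟩ := hX.exists_cokernel f
  have hc : (proj X).map f ≫ (proj X).map c = 0 := by
    rwa [← Functor.map_comp, hX.proj_map_eq_zero_iff]
  have := (hX.epi_proj_map_iff c).2 h₂
  have hl : ∀ {W : ModSub X} (t : (proj X).obj B ⟶ W), (proj X).map f ≫ t = 0 →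
      ∃ l, (proj X).map c ≫ l = t := by
    rintro ⟨W⟩ t ht
    obtain ⟨t, rfl⟩ := (proj X).map_surjective (Y := W) t
    obtain ⟨l, hl⟩ := h₃ W t (by
      rw [← hX.proj_map_eq_zero_iff, Functor.map_comp]
      exact ht)
    exact ⟨(proj X).map l, (Functor.map_comp _ _ _).symm.trans ((hX.proj_map_eq_iff _ _).2 hl)⟩
  exact ⟨⟨_, CokernelCofork.IsColimit.ofπ' _ hc fun t ht => ⟨_, (hl t ht).choose_spec⟩⟩⟩

/-- In `f = i ≫ q`, with `i` epi and `q` a weak kernel of `c`, a mono `f` makes `i` mono too, hence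
invertible. So `f` is itself a weak kernel of `c`, and a mono weak kernel is a kernel. -/
theorem isNormalMonoCategory (hb : BalancedMod X) :
    letI := hX.preadditive
    IsNormalMonoCategory (ModSub X) := by
  let _ := hX.preadditive
  have := hX.balanced_iff.2 hb
  refine ⟨?_⟩
  rintro ⟨A⟩ ⟨B⟩ f hf
  obtain ⟨f, rfl⟩ := (proj X).map_surjective (X := A) (Y := B) f
  obtain ⟨I, F, i, q, c, rfl, h₁, h₂, h₃⟩ := hX.exists_epi_comp_weakKernel f
  have := (hX.epi_proj_map_iff i).2 h₁
  have hm : Mono ((proj X).map i ≫ (proj X).map q) := by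
    rw [← Functor.map_comp]
    exact hf
  have := mono_of_mono ((proj X).map i) ((proj X).map q)
  have := isIso_of_mono_of_epi ((proj X).map i)
  have hc : (proj X).map (i ≫ q) ≫ (proj X).map c = 0 := by
    rw [← Functor.map_comp, hX.proj_map_eq_zero_iff, Category.assoc]
    exact h₂.comp_left i
  have hl : ∀ {W : ModSub X} (t : W ⟶ (proj X).obj B), t ≫ (proj X).map c = 0 →
      ∃ l, l ≫ (proj X).map (i ≫ q) = t := by
    rintro ⟨W⟩ t ht
    obtain ⟨t, rfl⟩ := (proj X).map_surjective (X := W) t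
    obtain ⟨l, hl⟩ := h₃ W t (by
      rw [← hX.proj_map_eq_zero_iff, Functor.map_comp]
      exact ht)
    refine ⟨(proj X).map l ≫ inv ((proj X).map i), ?_⟩
    rw [Functor.map_comp, Category.assoc, IsIso.inv_hom_id_assoc]
    exact (Functor.map_comp _ _ _).symm.trans ((hX.proj_map_eq_iff _ _).2 hl)
  exact ⟨⟨_, (proj X).map c, hc, KernelFork.IsLimit.ofι' (hi := hf) _ hc
    fun t ht => ⟨_, (hl t ht).choose_spec⟩⟩⟩

theorem isNormalEpiCategory (hb : BalancedMod X) :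
    letI := hX.preadditive
    IsNormalEpiCategory (ModSub X) := by
  let _ := hX.preadditive
  have := hX.balanced_iff.2 hb
  refine ⟨?_⟩
  rintro ⟨A⟩ ⟨B⟩ f hf
  obtain ⟨f, rfl⟩ := (proj X).map_surjective (X := A) (Y := B) f
  obtain ⟨I, F, i, q, c, rfl, h₁, h₂, h₃⟩ := hX.exists_weakCokernel_comp_mono f
  have := (hX.mono_proj_map_iff i).2 h₁
  have hm : Epi ((proj X).map q ≫ (proj X).map i) := by
    rw [← Functor.map_comp]
    exact hf
  have := epi_of_epi ((proj X).map q) ((proj X).map i)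
  have := isIso_of_mono_of_epi ((proj X).map i)
  have hc : (proj X).map c ≫ (proj X).map (q ≫ i) = 0 := by
    rw [← Functor.map_comp, hX.proj_map_eq_zero_iff, ← Category.assoc]
    exact h₂.comp_right i
  have hl : ∀ {W : ModSub X} (t : (proj X).obj A ⟶ W), (proj X).map c ≫ t = 0 →
      ∃ l, (proj X).map (q ≫ i) ≫ l = t := by
    rintro ⟨W⟩ t ht
    obtain ⟨t, rfl⟩ := (proj X).map_surjective (Y := W) t
    obtain ⟨l, hl⟩ := h₃ W t (by
      rw [← hX.proj_map_eq_zero_iff, Functor.map_comp]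
      exact ht)
    refine ⟨inv ((proj X).map i) ≫ (proj X).map l, ?_⟩
    rw [Functor.map_comp, Category.assoc, IsIso.hom_inv_id_assoc]
    exact (Functor.map_comp _ _ _).symm.trans ((hX.proj_map_eq_iff _ _).2 hl)
  exact ⟨⟨_, (proj X).map c, hc, CokernelCofork.IsColimit.ofπ' (hp := hf) _ hc
    fun t ht => ⟨_, (hl t ht).choose_spec⟩⟩⟩

/-- Finite products, kernels and cokernels exist in any case; balancedness is what supplies
normality of monomorphisms and epimorphisms. -/
theorem quotientIsAbelian_iff : hX.QuotientIsAbelian ↔ BalancedMod X := by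
  constructor
  · rintro ⟨h, -⟩
    exact hX.balanced_iff.1 inferInstance
  · intro hb
    let _ := hX.preadditive
    have := hX.hasFiniteProducts
    have := hX.hasKernels
    have := hX.hasCokernels
    have := hX.isNormalMonoCategory hb
    have := hX.isNormalEpiCategory hb
    exact ⟨{ }, rfl⟩

end Projection

end IsPseudoClusterTilting

end ExtriangulatedStructure

end Extri

theorem theorem3p15 {C : Type u} [Category.{v} C] [Preadditive C] [HasZeroObject C]
    [HasBinaryBiproducts C] (T : Extri.ExtriangulatedStructure.{w} C) (X : ObjectProperty C)
    (hX : T.IsPseudoClusterTilting X) :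
    List.TFAE [hX.QuotientIsAbelian,
      T.SelfOrthogonal X (T.classS X),
      T.SelfOrthogonal X (T.classT X)] := by
  rw [hX.quotientIsAbelian_iff]
  tfae_have 1 → 2 := hX.selfOrthogonal_classS
  tfae_have 2 → 1 := hX.balancedMod_of_classS
  tfae_have 1 → 3 := hX.selfOrthogonal_classT
  tfae_have 3 → 1 := hX.balancedMod_of_classT
  tfae_finish
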